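/- Let $(V,\omega)$ be a real symplectic vector space of dimension $2n$ and let $\Lambda$ be its Lagrangian Grassmannian, i.e. the manifold of all $n$-dimensional subspaces of $V$ on which $\omega$ vanishes. For transverse $L_0,L_1\in\Lambda$ let $\Lambda^0(L_1)\subset\Lambda$ be the open set of Lagrangians transverse to $L_1$, and for $L\in\Lambda^0(L_1)$ let $\varphi_{L_0,L_1}(L)=\omega(T\cdot,\cdot)|_{L_0\times L_0}$, where $T:L_0\to L_1$ is the linear map whose graph in $L_0\oplus L_1=V$ is $L$; this is a symmetric bilinear form on $L_0$. Let $n_+(B)$ denote the maximal dimension of a subspace on which a symmetric bilinear form $B$ is positive definite. For $L_0\in\Lambda$ and a continuous path $\ell:[a,b]\to\Lambda$, let $\mu_{L_0}(\ell)\in\mathbb Z$ be the $L_0$-Maslov index of $\ell$, that is, the integer which is additive by concatenation of paths, invariant under homotopies with fixed endpoints, and which satisfies $$\mu_{L_0}(\ell)=n_+\big[\varphi_{L_0,L_1}(\ell(b))\big]-n_+\big[\varphi_{L_0,L_1}(\ell(a))\big]$$ whenever $\ell([a,b])\subset\Lambda^0(L_1)$ for some Lagrangian $L_1$ transverse to $L_0$.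 Then, for every continuous path $\ell:[a,b]\to\Lambda$ and all $L_0,L_1\in\Lambda$, $$\big|\mu_{L_0}(\ell)-\mu_{L_1}(\ell)\big|\le n-\dim\big(\ell(a)\cap\ell(b)\big),$$ and, setting $$D=\mu_{L_0}(\ell)-\mu_{L_1}(\ell)-\dim\big(\ell(a)\cap L_0\big)+\dim\big(\ell(a)\cap L_1\big)+\dim\big(\ell(b)\cap L_0\big)-\dim\big(\ell(b)\cap L_1\big),$$ also $$|D|\le n-\dim(L_0\cap L_1)\qquad\text{and}\qquad |D|\le n-\dim\big(\ell(a)\cap\ell(b)\big).$$ -/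

import Mathlib

open Module Set

/-- A Lagrangian subspace of a (finite dimensional) real symplectic space `(V, ω)`:
an isotropic subspace of half the dimension of `V`.  The type of all of them is the
Lagrangian Grassmannian `Λ` of `(V, ω)`. -/
@[ext]
structure Lagr {V : Type*} [AddCommGroup V] [Module ℝ V] (ω : LinearMap.BilinForm ℝ V) where
  carrier : Submodule ℝ V
  isotropic : ∀ x ∈ carrier, ∀ y ∈ carrier, ω x y = 0
  two_mul_finrank : 2 * finrank ℝ carrier = finrank ℝ V

namespace Lagr

variable {V : Type*} [AddCommGroup V] [Module ℝ V] {ω : LinearMap.BilinForm ℝ V}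

/-- Transversality of two Lagrangians: `V = L ⊕ L'`.  The set `Λ⁰(L')` consists of all `L`
with `Transverse L L'`. -/
def Transverse (L L' : Lagr ω) : Prop := IsCompl L.carrier L'.carrier

/-- `dim (L ∩ L')`. -/
noncomputable def dimInter (L L' : Lagr ω) : ℕ :=
  finrank ℝ (L.carrier ⊓ L'.carrier : Submodule ℝ V)

/-- For `L` transverse to `L₁`, the linear map `T : L₀ → L₁` whose graph in `L₀ ⊕ L₁` is `L`
(see `mem_iff_graphMap`): since `v + T v ∈ L` and `T v ∈ L₁`, the vector `-T v` is the component
of `v` in `L₁` with respect to the decomposition `V = L₁ ⊕ L`. -/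
noncomputable def graphMap (L₀ L₁ L : Lagr ω) (h : Transverse L L₁) :
    L₀.carrier →ₗ[ℝ] L₁.carrier :=
  -(Submodule.projectionOnto L₁.carrier L.carrier h.symm ∘ₗ L₀.carrier.subtype)

/-- The chart `φ_{L₀,L₁}` at a Lagrangian `L ∈ Λ⁰(L₁)`: the bilinear form `ω(T·,·)` on `L₀`,
where `T : L₀ → L₁` is the linear map with graph `L`. It is symmetric, see `isSymm_chart`. -/
noncomputable def chart (L₀ L₁ L : Lagr ω) (h : Transverse L L₁) :
    LinearMap.BilinForm ℝ L₀.carrier :=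
  ω.compl₁₂ (L₁.carrier.subtype ∘ₗ graphMap L₀ L₁ L h) L₀.carrier.subtype

theorem add_graphMap_mem (L₀ L₁ L : Lagr ω) (h : Transverse L L₁) (v : L₀.carrier) :
    (v : V) + graphMap L₀ L₁ L h v ∈ L.carrier := by
  rw [← Submodule.projectionOnto_apply_eq_zero_iff (p := L₁.carrier) h.symm, map_add,
    Submodule.projectionOnto_apply_left]
  simp only [graphMap, LinearMap.neg_apply, LinearMap.comp_apply, Submodule.subtype_apply]
  abel

theorem mem_iff_graphMap (L₀ L₁ L : Lagr ω) (h₀₁ : Transverse L₀ L₁) (h : Transverse L L₁)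
    (x : V) : x ∈ L.carrier ↔ ∃ v : L₀.carrier, x = v + graphMap L₀ L₁ L h v := by
  constructor
  · intro hx
    obtain ⟨v, w, hv, hw, rfl⟩ := Submodule.codisjoint_iff_exists_add_eq.1 h₀₁.codisjoint x
    refine ⟨⟨v, hv⟩, ?_⟩
    have hsub := L.carrier.sub_mem hx (add_graphMap_mem L₀ L₁ L h ⟨v, hv⟩)
    have hsub' : w - graphMap L₀ L₁ L h ⟨v, hv⟩ ∈ L.carrier := by
      convert hsub using 1; abel
    have h0 := Submodule.disjoint_def.1 h.disjoint _ hsub'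
      (L₁.carrier.sub_mem hw (graphMap L₀ L₁ L h ⟨v, hv⟩).2)
    rw [sub_eq_zero] at h0
    rw [← h0]
  · rintro ⟨v, rfl⟩
    exact add_graphMap_mem L₀ L₁ L h v

theorem isSymm_chart (hω : ω.IsAlt) (L₀ L₁ L : Lagr ω) (h : Transverse L L₁) :
    (chart L₀ L₁ L h).IsSymm := by
  constructor
  intro u v
  have hL := L.isotropic _ (add_graphMap_mem L₀ L₁ L h u) _ (add_graphMap_mem L₀ L₁ L h v)
  have h0 := L₀.isotropic _ u.2 _ v.2
  have h1 := L₁.isotropic _ (graphMap L₀ L₁ L h u).2 _ (graphMap L₀ L₁ L h v).2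
  have hn := hω.neg_eq (u : V) (graphMap L₀ L₁ L h v : V)
  simp only [map_add, LinearMap.add_apply, h0, h1] at hL
  simp only [chart, LinearMap.compl₁₂_apply, LinearMap.comp_apply, Submodule.subtype_apply]
  linarith

/-- The topology of the Lagrangian Grassmannian as a manifold with the atlas of charts
`φ_{L₀,L₁} : Λ⁰(L₁) → B_sym(L₀)`, `(L₀, L₁)` ranging over the Lagrangian decompositions of `V`.
Since the charts are homeomorphisms from open subsets of `Λ`, the preimages of open sets under
the charts generate the topology.  The finite dimensional space of bilinear
forms on `L₀` carries its canonical vector space topology. -/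
instance instTopologicalSpace : TopologicalSpace (Lagr ω) :=
  TopologicalSpace.generateFrom
    {U | ∃ (L₀ L₁ : Lagr ω) (_ : Transverse L₀ L₁)
        (O : Set (LinearMap.BilinForm ℝ L₀.carrier)),
      @IsOpen _ (moduleTopology ℝ (LinearMap.BilinForm ℝ L₀.carrier)) O ∧
      U = {L | ∃ h : Transverse L L₁, chart L₀ L₁ L h ∈ O}}

/-- The coindex `n₊(B)`: the largest dimension of a subspace on which `B` is positive definite. -/
noncomputable def coindex {W : Type*} [AddCommGroup W] [Module ℝ W]
    (B : LinearMap.BilinForm ℝ W) : ℕ :=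
  _root_.sigPos (LinearMap.BilinMap.toQuadraticMap B)

/-- `HasMaslovIndex L₀ ℓ a b m`: the integer `m` is obtained as the `L₀`-Maslov index of the path
`ℓ : [a, b] → Λ` by the following two rules.
* `ofChart`: if `ℓ([a, b]) ⊆ Λ⁰(L₁)` for some `L₁` transverse to `L₀`, the index is
  `n₊(φ_{L₀,L₁}(ℓ(b))) - n₊(φ_{L₀,L₁}(ℓ(a)))`;
* `concat`: the index is additive by concatenation.

Equivalently: there is a partition of `[a, b]` such that `ℓ` maps each of its intervals
into the domain of a chart, and `m` is the sum of the contributions of these intervals. -/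
inductive HasMaslovIndex (L₀ : Lagr ω) (ℓ : ℝ → Lagr ω) : ℝ → ℝ → ℤ → Prop
  | ofChart (a b : ℝ) (hab : a ≤ b) (L₁ : Lagr ω) (h₀₁ : Transverse L₀ L₁)
      (h : ∀ t ∈ Icc a b, Transverse (ℓ t) L₁) :
      HasMaslovIndex L₀ ℓ a b
        ((coindex (chart L₀ L₁ (ℓ b) (h b ⟨hab, le_rfl⟩)) : ℤ)
          - (coindex (chart L₀ L₁ (ℓ a) (h a ⟨le_rfl, hab⟩)) : ℤ))
  | concat (a b c : ℝ) (m m' : ℤ) (h : HasMaslovIndex L₀ ℓ a b m)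
      (h' : HasMaslovIndex L₀ ℓ b c m') : HasMaslovIndex L₀ ℓ a c (m + m')

/-- The `L₀`-Maslov index `μ_{L₀}(ℓ) ∈ ℤ` of a continuous path `ℓ : [a, b] → Λ`: the integer
obtained by cutting the path into pieces that lie in chart domains.  For a continuous path
in the Lagrangian Grassmannian of a symplectic space this integer exists and does not depend on
the partition or on the charts. If it did not exist, the value would be an unspecified
integer. -/
noncomputable def maslovIndex (L₀ : Lagr ω) (ℓ : ℝ → Lagr ω) (a b : ℝ) : ℤ :=
  Classical.epsilon (HasMaslovIndex L₀ ℓ a b)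

end Lagr

/-!
For Lagrangians `A`, `B` transverse to `N`, write `c_N(A, B)` for the coindex of `chart A N B`. In
coordinates along `N` this is the coindex of the difference of two symmetric forms
(`Lagr.coindex_chart_eq`), whence `c_N(A, B) + c_N(B, A) = n - dim (A ∩ B)`
(`Lagr.coindex_chart_add_swap`), and subadditivity of the coindex gives the triangle inequality
`c_N(A, C) ≤ c_N(A, B) + c_N(B, C)` (`Lagr.coindex_chart_triangle`).

The Maslov index of a path within the domain of the chart along `N` is the increment of
`c_N(L₀, ·)`. The chart change formula `c_M(A, B) + c_N(M, B) = c_N(A, B) + c_N(M, A)`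
(`Lagr.coindex_chart_change`) compares the charts along `M` and `N`: the correction term
`c_N(M, B)` is locally constant in `B` as long as `B` is transverse to `M` and `N`, because the
coindex is locally constant at nondegenerate forms. It follows that, for any one `N` transverse to
`L₀`, `L₁`, `ℓ a`, `ℓ b`, and regardless of the partition and the charts,
`μ_{L₀}(ℓ) - μ_{L₁}(ℓ) = c_N(L₀, ℓ b) - c_N(L₀, ℓ a) - c_N(L₁, ℓ b) + c_N(L₁, ℓ a)`
(`Lagr.HasMaslovIndex.sub_eq_hormanderIndex`). Here the path itself need not stay transverse to `N`.
Together with the existence of the index (`Lagr.exists_hasMaslovIndex`), this identifies the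
difference of the values of `Lagr.maslovIndex`.

The three bounds are consequences of the triangle inequality. For instance
`c_N(L₀, ℓ b) - c_N(L₀, ℓ a) ≤ c_N(ℓ a, ℓ b)` and `c_N(L₁, ℓ a) - c_N(L₁, ℓ b) ≤ c_N(ℓ b, ℓ a)`
add up to the bound `n - dim (ℓ a ∩ ℓ b)`; the dimensions occurring in `D` turn each `c_N(X, Y)`
into `-c_N(Y, X)`.
-/

namespace Lagr

/-! ### The coindex of a symmetric form -/

section Coindex

variable {W : Type*} [AddCommGroup W] [Module ℝ W]

lemma restrict_toQuadraticMap_posDef_iff (B : LinearMap.BilinForm ℝ W) (P : Submodule ℝ W) :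
    ((LinearMap.BilinMap.toQuadraticMap B).restrict P).PosDef ↔ ∀ x ∈ P, x ≠ 0 → 0 < B x x := by
  simp [QuadraticMap.PosDef, QuadraticMap.restrict_apply]

lemma coindex_congr {W' : Type*} [AddCommGroup W'] [Module ℝ W']
    (B : LinearMap.BilinForm ℝ W) (B' : LinearMap.BilinForm ℝ W') (e : W ≃ₗ[ℝ] W')
    (h : ∀ x, B' (e x) (e x) = B x x) : coindex B = coindex B' :=
  QuadraticMap.Equivalent.sigPos_eq ⟨{ e with map_app' := fun x => by simpa using h x }⟩

variable [FiniteDimensional ℝ W]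

lemma exists_finrank_eq_coindex (B : LinearMap.BilinForm ℝ W) :
    ∃ P : Submodule ℝ W, finrank ℝ P = coindex B ∧ ∀ x ∈ P, x ≠ 0 → 0 < B x x := by
  obtain ⟨P, h, h'⟩ := exists_finrank_eq_sigPos_and_posDef (LinearMap.BilinMap.toQuadraticMap B)
  exact ⟨P, h, (restrict_toQuadraticMap_posDef_iff B P).1 h'⟩

/-- A lower bound for the coindex, from a parametrized subspace on which the form is positive
definite. -/
lemma finrank_le_coindex {E : Type*} [AddCommGroup E] [Module ℝ E]
    (B : LinearMap.BilinForm ℝ W) (f : E →ₗ[ℝ] W) (hf : ∀ x, x ≠ 0 → 0 < B (f x) (f x)) :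
    finrank ℝ E ≤ coindex B := by
  have hinj : Function.Injective f := by
    rw [← LinearMap.ker_eq_bot, LinearMap.ker_eq_bot']
    intro x hx
    by_contra h0
    simpa [hx] using hf x h0
  rw [← LinearMap.finrank_range_of_inj hinj]
  refine le_sigPos_of_posDef _ ((restrict_toQuadraticMap_posDef_iff B _).2 ?_)
  rintro _ ⟨x, rfl⟩ hx
  exact hf x fun h => hx (by simp [h])

/-- Rank of a symmetric form: coindex, index and nullity add up to the dimension. -/
lemma coindex_add_coindex_neg (B : LinearMap.BilinForm ℝ W) (hB : B.IsSymm) :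
    coindex B + coindex (-B) + finrank ℝ (LinearMap.ker B) = finrank ℝ W := by
  have hker : LinearMap.ker B = (LinearMap.BilinMap.toQuadraticMap B).radical := by
    ext x
    rw [QuadraticMap.mem_radical_iff']
    simp only [LinearMap.mem_ker, LinearMap.BilinMap.toQuadraticMap_apply, map_add,
      LinearMap.add_apply]
    constructor
    · intro h
      have h' : ∀ y, B y x = 0 := fun y => by rw [hB.eq y x]; simp [h]
      simp [h, h']
    · rintro ⟨h0, h⟩
      ext y
      have h1 := h y
      have h2 := hB.eq x y
      simp only [LinearMap.zero_apply]
      linarith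
  have h := QuadraticForm.sigPos_add_sigNeg_add_radical
    (Q := LinearMap.BilinMap.toQuadraticMap B)
  rw [hker, ← h, coindex, coindex, ← sigPos_neg]
  congr 3

/-- A maximal negative definite subspace together with the radical is a nonpositive subspace
complementary in dimension to a maximal positive definite one. -/
lemma exists_nonpos_finrank_add_coindex (B : LinearMap.BilinForm ℝ W) (hB : B.IsSymm) :
    ∃ N : Submodule ℝ W, finrank ℝ N + coindex B = finrank ℝ W ∧ ∀ x ∈ N, B x x ≤ 0 := by
  obtain ⟨P, hP, hneg⟩ := exists_finrank_eq_coindex (-B)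
  have hdisj : P ⊓ LinearMap.ker B = ⊥ := by
    rw [eq_bot_iff]
    rintro x ⟨hx, hk⟩
    by_contra h0
    have := hneg x hx (by simpa using h0)
    rw [LinearMap.neg_apply, LinearMap.mem_ker.1 hk] at this
    simp at this
  refine ⟨P ⊔ LinearMap.ker B, ?_, ?_⟩
  · have h1 := Submodule.finrank_sup_add_finrank_inf_eq P (LinearMap.ker B)
    rw [hdisj, finrank_bot] at h1
    have := coindex_add_coindex_neg B hB
    omega
  · intro x hx
    obtain ⟨p, hp, k, hk, rfl⟩ := Submodule.mem_sup.1 hx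
    have hk' : B k = 0 := hk
    have hpk : B p k = 0 := by simpa [hk'] using (hB.eq k p).symm
    have hp' : B p p ≤ 0 := by
      by_cases h0 : p = 0
      · simp [h0]
      · have := hneg p hp h0
        simp only [LinearMap.neg_apply] at this
        linarith
    simpa [hk', hpk] using hp'

lemma coindex_add_le (B C : LinearMap.BilinForm ℝ W) (hB : B.IsSymm) (hC : C.IsSymm) :
    coindex (B + C) ≤ coindex B + coindex C := by
  obtain ⟨P, hP, hpos⟩ := exists_finrank_eq_coindex (B + C)
  obtain ⟨M, hM, hM0⟩ := exists_nonpos_finrank_add_coindex B hB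
  obtain ⟨N, hN, hN0⟩ := exists_nonpos_finrank_add_coindex C hC
  have hdisj : P ⊓ (M ⊓ N) = ⊥ := by
    rw [eq_bot_iff]
    rintro x ⟨hx, hxM, hxN⟩
    by_contra h0
    have h1 := hpos x hx (by simpa using h0)
    have h2 := hM0 x hxM
    have h3 := hN0 x hxN
    simp only [LinearMap.add_apply] at h1
    linarith
  have h1 := Submodule.finrank_sup_add_finrank_inf_eq P (M ⊓ N)
  have h2 := Submodule.finrank_sup_add_finrank_inf_eq M N
  rw [hdisj, finrank_bot] at h1
  have h3 := Submodule.finrank_le (P ⊔ M ⊓ N)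
  have h4 := Submodule.finrank_le (M ⊔ N)
  omega

/-- The coindex is lower semicontinuous. On a maximal positive definite subspace with orthogonal
basis `v`, positivity persists while all the values `B (v i) (v j)` change by little. -/
lemma exists_isOpen_coindex_le (B₀ : LinearMap.BilinForm ℝ W) (hB₀ : B₀.IsSymm) :
    ∃ O : Set (LinearMap.BilinForm ℝ W),
      @IsOpen _ (moduleTopology ℝ (LinearMap.BilinForm ℝ W)) O ∧ B₀ ∈ O ∧
      ∀ B ∈ O, coindex B₀ ≤ coindex B := by
  let _ : TopologicalSpace (LinearMap.BilinForm ℝ W) := moduleTopology ℝ _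
  have _ : IsModuleTopology ℝ (LinearMap.BilinForm ℝ W) := ⟨rfl⟩
  obtain ⟨P, hP, hpos⟩ := exists_finrank_eq_coindex B₀
  have _ : Invertible (2 : ℝ) := invertibleOfNonzero two_ne_zero
  have hsymm : (B₀.restrict P).IsSymm := ⟨fun x y => hB₀.eq x y⟩
  obtain ⟨k, v, hv⟩ : ∃ k, ∃ v : Basis (Fin k) ℝ P, LinearMap.IsOrthoᵢ (B₀.restrict P) v :=
    ⟨_, LinearMap.BilinForm.exists_orthogonal_basis (LinearMap.BilinForm.isSymm_iff.1 hsymm)⟩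
  have hvpos : ∀ i, 0 < B₀ (v i) (v i) := fun i =>
    hpos _ (v i).2 (by simpa using v.ne_zero i)
  have hv0 : ∀ i j, i ≠ j → B₀ (v i) (v j) = 0 := fun i j hij => hv hij
  obtain ⟨ε, hε, hεv⟩ : ∃ ε : ℝ, 0 < ε ∧ ∀ i, ε ≤ B₀ (v i) (v i) := by
    have : ∀ᶠ ε in nhdsWithin (0 : ℝ) (Ioi 0), ∀ i, ε ≤ B₀ (v i) (v i) :=
      Filter.eventually_all.2 fun i =>
        Filter.Eventually.filter_mono nhdsWithin_le_nhds (Iic_mem_nhds (hvpos i))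
    obtain ⟨ε, h1, h2⟩ := (this.and self_mem_nhdsWithin).exists
    exact ⟨ε, h2, h1⟩
  let ev (i j : Fin k) : LinearMap.BilinForm ℝ W →ₗ[ℝ] ℝ :=
    LinearMap.applyₗ (v j : W) ∘ₗ LinearMap.applyₗ (v i : W)
  have hev : ∀ i j B, ev i j B = B (v i) (v j) := fun _ _ _ => rfl
  -- The `k²` values change by less than `ε / (k + 1)` each, which perturbs `B₀ x x ≥ ε ∑ xᵢ²` by at
  -- most `ε * k / (k + 1) * ∑ xᵢ²`.
  refine ⟨⋂ i, ⋂ j, ev i j ⁻¹' Metric.ball (B₀ (v i) (v j)) (ε / (k + 1)), ?_, ?_, ?_⟩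
  · exact isOpen_iInter_of_finite fun i => isOpen_iInter_of_finite fun j =>
      Metric.isOpen_ball.preimage (IsModuleTopology.continuous_of_linearMap (ev i j))
  · simp only [mem_iInter, mem_preimage, hev]
    exact fun i j => Metric.mem_ball_self (by positivity)
  · intro B hB
    simp only [mem_iInter, mem_preimage, hev, Metric.mem_ball, Real.dist_eq] at hB
    rw [← hP]
    refine finrank_le_coindex B P.subtype fun x hx => ?_
    have hsum : ∀ C : LinearMap.BilinForm ℝ W,
        C x x = ∑ i, ∑ j, v.repr x i * v.repr x j * C (v i) (v j) := by
      intro C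
      have hx' : (x : W) = ∑ i, v.repr x i • (v i : W) := by
        simpa only [Submodule.coe_sum, Submodule.coe_smul] using
          congrArg Subtype.val (v.sum_repr x).symm
      conv_lhs => rw [hx']
      simp only [map_sum, map_smul, LinearMap.sum_apply, LinearMap.smul_apply, smul_eq_mul,
        Finset.mul_sum]
      rw [Finset.sum_comm]
      exact Finset.sum_congr rfl fun i _ => Finset.sum_congr rfl fun j _ => by ring
    have hnorm : 0 < ∑ i, v.repr x i ^ 2 := by
      obtain ⟨i, hi⟩ : ∃ i, v.repr x i ≠ 0 := by
        by_contra! h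
        exact hx (v.repr.map_eq_zero_iff.1 (Finsupp.ext h))
      exact Finset.sum_pos' (fun i _ => sq_nonneg _) ⟨i, Finset.mem_univ _, by positivity⟩
    have h₀ : ε * ∑ i, v.repr x i ^ 2 ≤ B₀ x x := by
      rw [hsum B₀, Finset.mul_sum]
      refine Finset.sum_le_sum fun i _ => ?_
      rw [Finset.sum_eq_single i (fun j _ hj => by rw [hv0 i j hj.symm, mul_zero]) (by simp)]
      nlinarith [hεv i, sq_nonneg (v.repr x i)]
    have h₁ : B₀ x x - B x x ≤ ε / (k + 1) * (k * ∑ i, v.repr x i ^ 2) := by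
      have hterm : ∀ i j, v.repr x i * v.repr x j * (B₀ (v i) (v j) - B (v i) (v j))
          ≤ ε / (k + 1) * ((v.repr x i ^ 2 + v.repr x j ^ 2) / 2) := by
        intro i j
        refine (le_abs_self _).trans ?_
        rw [abs_mul, mul_comm]
        have hxy : |v.repr x i * v.repr x j| ≤ (v.repr x i ^ 2 + v.repr x j ^ 2) / 2 := by
          rw [abs_le]
          constructor <;> nlinarith [sq_nonneg (v.repr x i - v.repr x j),
            sq_nonneg (v.repr x i + v.repr x j)]
        exact mul_le_mul (by rw [abs_sub_comm]; exact (hB i j).le) hxy (abs_nonneg _)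
          (by positivity)
      rw [hsum B₀, hsum B, ← Finset.sum_sub_distrib]
      simp only [← Finset.sum_sub_distrib, ← mul_sub]
      refine (Finset.sum_le_sum fun i _ => Finset.sum_le_sum fun j _ => hterm i j).trans_eq ?_
      simp only [← Finset.mul_sum, ← Finset.sum_div, Finset.sum_add_distrib, Finset.sum_const,
        Finset.card_univ, Fintype.card_fin, nsmul_eq_mul]
      ring
    have h₂ : ε / (k + 1) * (k * ∑ i, v.repr x i ^ 2) < ε * ∑ i, v.repr x i ^ 2 := by
      rw [div_mul_eq_mul_div, div_lt_iff₀ (by positivity)]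
      nlinarith [mul_pos hε hnorm]
    simp only [Submodule.subtype_apply]
    linarith

/-- The coindex is locally constant at a nondegenerate form. -/
lemma exists_isOpen_coindex_eq (B₀ : LinearMap.BilinForm ℝ W) (hB₀ : B₀.IsSymm)
    (hker : LinearMap.ker B₀ = ⊥) :
    ∃ O : Set (LinearMap.BilinForm ℝ W),
      @IsOpen _ (moduleTopology ℝ (LinearMap.BilinForm ℝ W)) O ∧ B₀ ∈ O ∧
      ∀ B ∈ O, B.IsSymm → coindex B = coindex B₀ := by
  let _ : TopologicalSpace (LinearMap.BilinForm ℝ W) := moduleTopology ℝ _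
  have _ : IsModuleTopology ℝ (LinearMap.BilinForm ℝ W) := ⟨rfl⟩
  have _ := IsModuleTopology.toContinuousAdd ℝ (LinearMap.BilinForm ℝ W)
  obtain ⟨O, hO, hmem, hle⟩ := exists_isOpen_coindex_le B₀ hB₀
  obtain ⟨O', hO', hmem', hle'⟩ := exists_isOpen_coindex_le (-B₀) hB₀.neg
  refine ⟨O ∩ LinearEquiv.neg ℝ ⁻¹' O',
    hO.inter (hO'.preimage (IsModuleTopology.continuous_of_linearMap
      (LinearEquiv.neg ℝ).toLinearMap)), ⟨hmem, by simpa using hmem'⟩, ?_⟩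
  rintro B ⟨h1, h2⟩ hB
  have h3 := hle B h1
  have h4 : coindex (-B₀) ≤ coindex (-B) := hle' _ h2
  have h5 := coindex_add_coindex_neg B hB
  have h6 := coindex_add_coindex_neg B₀ hB₀
  rw [hker, finrank_bot] at h6
  omega

end Coindex

/-! ### Relative position of Lagrangians in charts -/

section Charts

variable {V : Type*} [AddCommGroup V] [Module ℝ V] {ω : LinearMap.BilinForm ℝ V}

lemma Transverse.symm {A B : Lagr ω} (h : Transverse A B) : Transverse B A := IsCompl.symm h

lemma dimInter_eq_zero {A B : Lagr ω} (h : Transverse A B) : A.dimInter B = 0 := by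
  rw [dimInter, h.inf_eq_bot, finrank_bot]

lemma finrank_carrier_eq (A B : Lagr ω) : finrank ℝ A.carrier = finrank ℝ B.carrier := by
  have := A.two_mul_finrank
  have := B.two_mul_finrank
  omega

lemma chart_apply (R N B : Lagr ω) (h : Transverse B N) (x y : R.carrier) :
    chart R N B h x y = ω (graphMap R N B h x : V) (y : V) := rfl

lemma graphMap_eq_of_add_mem {R N B : Lagr ω} (h : Transverse B N) {x : R.carrier}
    {u : N.carrier} (hu : (x : V) + u ∈ B.carrier) : graphMap R N B h x = u := by
  have h1 := B.carrier.sub_mem (add_graphMap_mem R N B h x) hu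
  rw [add_sub_add_left_eq_sub] at h1
  have h2 := Submodule.disjoint_def.1 h.disjoint _ h1
    (N.carrier.sub_mem (graphMap R N B h x).2 u.2)
  exact Subtype.ext (sub_eq_zero.1 h2)

lemma chart_self (R N : Lagr ω) (h : Transverse R N) : chart R N R h = 0 := by
  ext x y
  have : graphMap R N R h x = 0 := graphMap_eq_of_add_mem h (by simp)
  simp [chart_apply, this]

/-- By nondegeneracy, a vector orthogonal to two transverse Lagrangians vanishes. -/
lemma eq_zero_of_orthogonal (hnd : ω.Nondegenerate) {A N : Lagr ω} (h : Transverse A N) {u : V}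
    (hA : ∀ a ∈ A.carrier, ω u a = 0) (hN : ∀ c ∈ N.carrier, ω u c = 0) : u = 0 := by
  refine hnd.1 u fun y => ?_
  obtain ⟨a, c, ha, hc, rfl⟩ := Submodule.codisjoint_iff_exists_add_eq.1 h.codisjoint y
  rw [map_add, hA a ha, hN c hc, add_zero]

lemma mem_ker_chart_iff (hnd : ω.Nondegenerate) {A N B : Lagr ω} (hA : Transverse A N)
    (h : Transverse B N) (x : A.carrier) :
    x ∈ LinearMap.ker (chart A N B h) ↔ (x : V) ∈ B.carrier := by
  constructor
  · intro hx
    have h0 : (graphMap A N B h x : V) = 0 :=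
      eq_zero_of_orthogonal hnd hA
        (fun a ha => by
          have := LinearMap.congr_fun (LinearMap.mem_ker.1 hx) ⟨a, ha⟩
          simpa [chart_apply] using this)
        (fun c hc => N.isotropic _ (graphMap A N B h x).2 _ hc)
    simpa [h0] using add_graphMap_mem A N B h x
  · intro hx
    have h0 : graphMap A N B h x = 0 := graphMap_eq_of_add_mem h (by simpa using hx)
    rw [LinearMap.mem_ker]
    ext y
    simp [chart_apply, h0]

lemma finrank_ker_chart (hnd : ω.Nondegenerate) {A N B : Lagr ω} (hA : Transverse A N)
    (h : Transverse B N) : finrank ℝ (LinearMap.ker (chart A N B h)) = A.dimInter B := by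
  have : LinearMap.ker (chart A N B h) = B.carrier.comap A.carrier.subtype := by
    ext x
    exact mem_ker_chart_iff hnd hA h x
  rw [this, ← Submodule.finrank_map_subtype_eq, Submodule.map_comap_subtype, dimInter]

variable [FiniteDimensional ℝ V]

/-- The projection along `N` between two Lagrangians transverse to `N`. -/
noncomputable def graphEquiv (R N A : Lagr ω) (hR : Transverse R N) (hA : Transverse A N) :
    R.carrier ≃ₗ[ℝ] A.carrier :=
  LinearMap.linearEquivOfInjective
    (LinearMap.codRestrict A.carrier
      (R.carrier.subtype + N.carrier.subtype ∘ₗ graphMap R N A hA)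
      (fun x => add_graphMap_mem R N A hA x))
    (by
      rw [← LinearMap.ker_eq_bot, LinearMap.ker_eq_bot']
      intro x hx
      have h1 : (x : V) + graphMap R N A hA x = 0 := congrArg Subtype.val hx
      have h2 : (x : V) ∈ N.carrier := by
        rw [eq_neg_of_add_eq_zero_left h1]
        exact N.carrier.neg_mem (graphMap R N A hA x).2
      exact Subtype.ext (Submodule.disjoint_def.1 hR.disjoint _ x.2 h2))
    (finrank_carrier_eq R A)

lemma coe_graphEquiv (R N A : Lagr ω) (hR : Transverse R N) (hA : Transverse A N)
    (x : R.carrier) : (graphEquiv R N A hR hA x : V) = x + graphMap R N A hA x := rfl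

/-- In the chart based at `R`, the relative position of `A` and `B` is the difference of their
coordinates. -/
lemma coindex_chart_eq (R N A B : Lagr ω) (hR : Transverse R N) (hA : Transverse A N)
    (hB : Transverse B N) :
    coindex (chart A N B hB) = coindex (chart R N B hB - chart R N A hA) := by
  symm
  refine coindex_congr _ _ (graphEquiv R N A hR hA) fun x => ?_
  have hg : graphMap A N B hB (graphEquiv R N A hR hA x)
      = graphMap R N B hB x - graphMap R N A hA x := by
    apply graphMap_eq_of_add_mem
    rw [coe_graphEquiv, Submodule.coe_sub, add_add_sub_cancel]
    exact add_graphMap_mem R N B hB x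
  rw [chart_apply, hg, coe_graphEquiv, map_add,
    N.isotropic _ (graphMap R N B hB x - graphMap R N A hA x).2 _ (graphMap R N A hA x).2]
  simp [chart_apply]

lemma coindex_chart_swap (N A B : Lagr ω) (hA : Transverse A N) (hB : Transverse B N) :
    coindex (chart B N A hA) = coindex (-chart A N B hB) := by
  rw [coindex_chart_eq A N B A hA hB hA, chart_self]
  congr 1
  ext x y
  simp

/-- `coindex (chart A N B) + coindex (chart B N A) = n - dim (A ∩ B)`: the two forms are opposite
to each other under the projection along `N`. -/
lemma coindex_chart_add_swap (hω : ω.IsAlt) (hnd : ω.Nondegenerate) (N A B : Lagr ω)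
    (hA : Transverse A N) (hB : Transverse B N) :
    coindex (chart A N B hB) + coindex (chart B N A hA) + A.dimInter B
      = finrank ℝ A.carrier := by
  rw [coindex_chart_swap N A B hA hB, ← finrank_ker_chart hnd hA hB]
  exact coindex_add_coindex_neg _ (isSymm_chart hω A N B hB)

/-- The triangle inequality, an instance of the subadditivity of the coindex. -/
lemma coindex_chart_triangle (hω : ω.IsAlt) (N A B C : Lagr ω)
    (hA : Transverse A N) (hB : Transverse B N) (hC : Transverse C N) :
    coindex (chart A N C hC) ≤ coindex (chart A N B hB) + coindex (chart B N C hC) := by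
  rw [coindex_chart_eq A N B C hA hB hC]
  have hBs := isSymm_chart hω A N B hB
  refine le_trans (le_of_eq (congrArg coindex ?_))
    (coindex_add_le _ _ hBs ((isSymm_chart hω A N C hC).sub hBs))
  ext x y
  simp

/-- One half of the chart change formula. In the decomposition `V = C ⊕ N`, let `α`, `β` be the
coordinates of `A`, `B`, forms on `C`. Each pair `x, z : C` with `α x = β z` gives the vector
`x + T x = z + T z - (z - x)` of `A` (`T` being the respective graph maps), at which the form of
`B` in the chart along `C` has the value `α x x - β z z`. Writing `x = p + d`, `z = q + d`, this
value is `α p p - β q q + (β - α) d d`; it is positive when `p`, `q`, `d` range over positive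
definite subspaces of `α`, `-β`, `β - α`, and `α x = β z` amounts to `n` linear equations. -/
lemma coindex_chart_cycle_le (hω : ω.IsAlt) (hnd : ω.Nondegenerate) (N A B C : Lagr ω)
    (hA : Transverse A N) (hB : Transverse B N) (hC : Transverse C N) (hBC : Transverse B C) :
    coindex (chart A N B hB) + coindex (chart B N C hC) + coindex (chart C N A hA)
      ≤ finrank ℝ A.carrier + coindex (chart A C B hBC) := by
  rw [coindex_chart_eq C N A B hC hA hB, coindex_chart_swap N C B hC hB]
  have hα := isSymm_chart hω C N A hA
  have hβ := isSymm_chart hω C N B hB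
  set α := chart C N A hA with hαdef
  set β := chart C N B hB with hβdef
  obtain ⟨P, hP, hPpos⟩ := exists_finrank_eq_coindex α
  obtain ⟨Q, hQ, hQpos⟩ := exists_finrank_eq_coindex (-β)
  obtain ⟨D, hD, hDpos⟩ := exists_finrank_eq_coindex (β - α)
  let xm : P × Q × D →ₗ[ℝ] C.carrier :=
    P.subtype ∘ₗ LinearMap.fst ℝ P (Q × D) +
      D.subtype ∘ₗ LinearMap.snd ℝ Q D ∘ₗ LinearMap.snd ℝ P (Q × D)
  let zm : P × Q × D →ₗ[ℝ] C.carrier :=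
    Q.subtype ∘ₗ LinearMap.fst ℝ Q D ∘ₗ LinearMap.snd ℝ P (Q × D) +
      D.subtype ∘ₗ LinearMap.snd ℝ Q D ∘ₗ LinearMap.snd ℝ P (Q × D)
  let g : P × Q × D →ₗ[ℝ] Module.Dual ℝ C.carrier := α ∘ₗ xm - β ∘ₗ zm
  have hdim : coindex (β - α) + coindex (-β) + coindex α
      ≤ finrank ℝ A.carrier + finrank ℝ (LinearMap.ker g) := by
    have h1 := LinearMap.finrank_range_add_finrank_ker g
    have h2 := Submodule.finrank_le (LinearMap.range g)
    rw [Subspace.dual_finrank_eq, finrank_carrier_eq C A] at h2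
    rw [finrank_prod, finrank_prod] at h1
    omega
  refine hdim.trans (Nat.add_le_add_left ?_ _)
  refine finrank_le_coindex (E := LinearMap.ker g) _
    ((graphEquiv C N A hC hA).toLinearMap ∘ₗ xm ∘ₗ (LinearMap.ker g).subtype) ?_
  rintro ⟨⟨p, q, d⟩, hg⟩ hne
  obtain ⟨x, hx⟩ : ∃ x : C.carrier, x = (p : C.carrier) + d := ⟨_, rfl⟩
  obtain ⟨z, hz⟩ : ∃ z : C.carrier, z = (q : C.carrier) + d := ⟨_, rfl⟩
  have hxz : α x = β z := by
    rw [hx, hz]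
    exact sub_eq_zero.1 (LinearMap.mem_ker.1 hg)
  have hT : graphMap C N A hA x = graphMap C N B hB z := by
    refine Subtype.ext (sub_eq_zero.1 (eq_zero_of_orthogonal hnd hC (fun c hc => ?_)
      fun c hc => N.isotropic _ (graphMap C N A hA x - graphMap C N B hB z).2 _ hc))
    have := LinearMap.congr_fun hxz ⟨c, hc⟩
    rw [hαdef, hβdef, chart_apply, chart_apply] at this
    rw [map_sub, LinearMap.sub_apply, this, sub_self]
  have hS : graphMap A C B hBC (graphEquiv C N A hC hA x) = z - x := by
    apply graphMap_eq_of_add_mem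
    rw [coe_graphEquiv, Submodule.coe_sub, hT]
    convert add_graphMap_mem C N B hB z using 1
    abel
  have hval : chart A C B hBC (graphEquiv C N A hC hA x) (graphEquiv C N A hC hA x)
      = α x x - β z z := by
    rw [chart_apply, hS, coe_graphEquiv, map_add, C.isotropic _ (z - x).2 _ x.2, zero_add,
      ← hω.neg_eq, ← hxz, hαdef, chart_apply, chart_apply]
    simp
  have hexp : α x x - β z z = α p p + (-β) q q + (β - α) d d := by
    have h1 := LinearMap.congr_fun hxz (d : C.carrier)
    have h2 := hα.eq d p
    have h3 := hβ.eq d q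
    rw [hx, hz] at h1
    rw [hx, hz]
    simp only [map_add, LinearMap.add_apply, LinearMap.sub_apply, LinearMap.neg_apply] at h1 ⊢
    linarith
  change 0 < chart A C B hBC (graphEquiv C N A hC hA ((p : C.carrier) + d))
    (graphEquiv C N A hC hA ((p : C.carrier) + d))
  rw [← hx, hval, hexp]
  have nonneg : ∀ (S : Submodule ℝ C.carrier) (F : LinearMap.BilinForm ℝ C.carrier),
      (∀ x ∈ S, x ≠ 0 → 0 < F x x) → ∀ s : S, 0 ≤ F s s := by
    intro S F hF s
    by_cases h0 : (s : C.carrier) = 0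
    · simp [h0]
    · exact (hF s s.2 h0).le
  have hp := nonneg P α hPpos p
  have hq := nonneg Q (-β) hQpos q
  have hd := nonneg D (β - α) hDpos d
  by_contra hcon
  have hp0 : (p : C.carrier) = 0 := by
    by_contra h0
    linarith [hPpos p p.2 h0]
  have hq0 : (q : C.carrier) = 0 := by
    by_contra h0
    linarith [hQpos q q.2 h0]
  have hd0 : (d : C.carrier) = 0 := by
    by_contra h0
    linarith [hDpos d d.2 h0]
  exact hne (by ext <;> simp [hp0, hq0, hd0])

/-- The chart change formula: passing from charts along `N` to charts along `M` changes the
coindex of `B` relative to `A` by terms that involve `A` and `B` separately. The inequality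
`coindex_chart_cycle_le` and the one with `A` and `B` exchanged add up to an equality, whence
both are equalities. -/
lemma coindex_chart_change (hω : ω.IsAlt) (hnd : ω.Nondegenerate) (N M A B : Lagr ω)
    (hA : Transverse A N) (hB : Transverse B N) (hM : Transverse M N)
    (hAM : Transverse A M) (hBM : Transverse B M) :
    coindex (chart A M B hBM) + coindex (chart M N B hB)
      = coindex (chart A N B hB) + coindex (chart M N A hA) := by
  have h1 := coindex_chart_cycle_le hω hnd N A B M hA hB hM hBM
  have h2 := coindex_chart_cycle_le hω hnd N B A M hB hA hM hAM
  have h3 := coindex_chart_add_swap hω hnd N A B hA hB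
  have h4 := coindex_chart_add_swap hω hnd M A B hAM hBM
  have h5 := coindex_chart_add_swap hω hnd N A M hA hM
  have h6 := coindex_chart_add_swap hω hnd N B M hB hM
  rw [dimInter_eq_zero hAM] at h5
  rw [dimInter_eq_zero hBM] at h6
  have h7 := finrank_carrier_eq A B
  omega

/-- Finitely many Lagrangians have a common transverse Lagrangian. An isotropic subspace `W`
meeting each `L ∈ S` trivially is enlarged by a vector of its orthogonal complement outside of the
subspaces `W ⊔ L`; none of them contains the complement, as long as `dim W < n`. -/
lemma exists_transverse (hω : ω.IsAlt) (hnd : ω.Nondegenerate) (S : Set (Lagr ω))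
    (hS : S.Finite) (hne : S.Nonempty) : ∃ N : Lagr ω, ∀ L ∈ S, Transverse L N := by
  classical
  obtain ⟨L₀, hL₀⟩ := hne
  have hortho : ∀ L : Lagr ω, ω.orthogonal L.carrier = L.carrier := by
    intro L
    symm
    apply Submodule.eq_of_le_of_finrank_eq
    · exact fun x hx => LinearMap.BilinForm.mem_orthogonal_iff.2 fun y hy => L.isotropic y hy x hx
    · rw [LinearMap.BilinForm.finrank_orthogonal hnd]
      have := L.two_mul_finrank
      omega
  have key : ∀ k ≤ finrank ℝ L₀.carrier, ∃ W : Submodule ℝ V,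
      (∀ x ∈ W, ∀ y ∈ W, ω x y = 0) ∧ finrank ℝ W = k ∧ ∀ L ∈ S, Disjoint L.carrier W := by
    intro k
    induction k with
    | zero => exact fun _ => ⟨⊥, by simp, by simp, by simp⟩
    | succ k ih =>
      intro hk
      obtain ⟨W, hiso, hrank, hdisj⟩ := ih (by omega)
      obtain ⟨x, hxW, hx⟩ : ∃ x ∈ ω.orthogonal W, ∀ L ∈ S, x ∉ W ⊔ L.carrier := by
        let F : Finset (Subspace ℝ (ω.orthogonal W)) :=
          hS.toFinset.image fun L => (W ⊔ L.carrier).comap (ω.orthogonal W).subtype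
        have hF : ⊤ ∉ F := by
          intro htop
          obtain ⟨L, hL, hLtop⟩ := Finset.mem_image.1 htop
          rw [Submodule.comap_subtype_eq_top] at hLtop
          have h1 : ω.orthogonal (W ⊔ L.carrier) = ⊥ := by
            rw [eq_bot_iff]
            intro y hy
            have hyW : y ∈ W := by
              rw [← LinearMap.BilinForm.orthogonal_orthogonal hnd hω.isRefl W]
              exact LinearMap.BilinForm.orthogonal_le hLtop hy
            have hyL : y ∈ L.carrier := by
              rw [← hortho L]
              exact LinearMap.BilinForm.orthogonal_le le_sup_right hy
            exact Submodule.disjoint_def.1 (hdisj L (hS.mem_toFinset.1 hL)) y hyL hyW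
          have h2 := LinearMap.BilinForm.finrank_orthogonal hnd (W ⊔ L.carrier)
          rw [h1, finrank_bot] at h2
          have h3 := Submodule.finrank_add_le_finrank_add_finrank W L.carrier
          have h4 := L.two_mul_finrank
          have h5 := finrank_carrier_eq L L₀
          omega
        obtain ⟨x, hx⟩ := (ne_univ_iff_exists_notMem _).1
          (Subspace.biUnion_ne_univ_of_top_notMem hF)
        refine ⟨x, x.2, fun L hL hxL => hx ?_⟩
        exact mem_biUnion (Finset.mem_image_of_mem _ (hS.mem_toFinset.2 hL)) hxL
      have hWx : ∀ w ∈ W, ω w x = 0 := LinearMap.BilinForm.mem_orthogonal_iff.1 hxW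
      have hx0 : x ∉ W := fun h => hx L₀ hL₀ (Submodule.mem_sup_left h)
      have hx0' : x ≠ 0 := fun h => hx0 (by rw [h]; exact W.zero_mem)
      refine ⟨W ⊔ ℝ ∙ x, ?_, ?_, ?_⟩
      · intro u hu v hv
        obtain ⟨w, hw, c, hc, rfl⟩ := Submodule.mem_sup.1 hu
        obtain ⟨w', hw', c', hc', rfl⟩ := Submodule.mem_sup.1 hv
        obtain ⟨r, rfl⟩ := Submodule.mem_span_singleton.1 hc
        obtain ⟨r', rfl⟩ := Submodule.mem_span_singleton.1 hc'
        have h1 : ω x w' = 0 := by rw [← hω.neg_eq, hWx w' hw', neg_zero]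
        simp [hiso w hw w' hw', hWx w hw, h1, hω x]
      · have hd : W ⊓ ℝ ∙ x = ⊥ :=
          (Submodule.disjoint_span_singleton' hx0').2 hx0 |>.eq_bot
        have h1 := Submodule.finrank_sup_add_finrank_inf_eq W (ℝ ∙ x)
        rw [hd, finrank_bot, finrank_span_singleton hx0', hrank] at h1
        exact h1
      · intro L hL
        rw [Submodule.disjoint_def]
        intro u huL hu
        obtain ⟨w, hw, c, hc, rfl⟩ := Submodule.mem_sup.1 hu
        obtain ⟨r, rfl⟩ := Submodule.mem_span_singleton.1 hc
        have hr : r = 0 := by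
          by_contra hr
          refine hx L hL ?_
          have h1 : r • x = -w + (w + r • x) := by abel
          have h2 : r • x ∈ W ⊔ L.carrier := by
            rw [h1]
            exact Submodule.add_mem_sup (W.neg_mem hw) huL
          exact (Submodule.smul_mem_iff _ hr).1 h2
        subst hr
        rw [zero_smul, add_zero] at huL ⊢
        exact Submodule.disjoint_def.1 (hdisj L hL) w huL hw
  obtain ⟨W, hiso, hrank, hdisj⟩ := key _ le_rfl
  refine ⟨⟨W, hiso, by rw [hrank, L₀.two_mul_finrank]⟩, fun L hL => ?_⟩
  refine (Submodule.isCompl_iff_disjoint _ _ ?_).2 (hdisj L hL)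
  rw [hrank, finrank_carrier_eq L L₀, ← L₀.two_mul_finrank, two_mul]

end Charts

/-! ### The Maslov index of a path -/

section Paths

open Filter Topology

variable {V : Type*} [AddCommGroup V] [Module ℝ V] {ω : LinearMap.BilinForm ℝ V}

/-- The Hörmander index of two pairs `X, Y` and `A, B` of Lagrangians, computed in charts along
`N`: the difference between the changes, from `A` to `B`, of the coindex relative to `X` and of the
coindex relative to `Y`. It does not depend on `N`, provided that `X`, `Y` are transverse to `N`
as well, see `hormanderIndex_eq`. -/
noncomputable def hormanderIndex (X Y N A B : Lagr ω) (hA : Transverse A N)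
    (hB : Transverse B N) : ℤ :=
  ((coindex (chart X N B hB) : ℤ) - coindex (chart X N A hA))
    - ((coindex (chart Y N B hB) : ℤ) - coindex (chart Y N A hA))

lemma hormanderIndex_add (X Y N A B C : Lagr ω) (hA : Transverse A N) (hB : Transverse B N)
    (hC : Transverse C N) :
    hormanderIndex X Y N A B hA hB + hormanderIndex X Y N B C hB hC
      = hormanderIndex X Y N A C hA hC := by
  simp only [hormanderIndex]
  ring

lemma hormanderIndex_swap (X Y N A B : Lagr ω) (hA : Transverse A N) (hB : Transverse B N) :
    hormanderIndex X Y N B A hB hA = -hormanderIndex X Y N A B hA hB := by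
  simp only [hormanderIndex]
  ring

lemma HasMaslovIndex.le {L : Lagr ω} {ℓ : ℝ → Lagr ω} {a b : ℝ} {m : ℤ}
    (h : HasMaslovIndex L ℓ a b m) : a ≤ b := by
  induction h with
  | ofChart a b hab => exact hab
  | concat a b c m m' _ _ h h' => exact h.trans h'

lemma HasMaslovIndex.exists_split {L : Lagr ω} {ℓ : ℝ → Lagr ω} {a b : ℝ} {m : ℤ}
    (h : HasMaslovIndex L ℓ a b m) : ∀ c ∈ Icc a b, ∃ m₁ m₂ : ℤ,
      HasMaslovIndex L ℓ a c m₁ ∧ HasMaslovIndex L ℓ c b m₂ ∧ m₁ + m₂ = m := by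
  induction h with
  | ofChart a b hab M hM hℓ =>
    intro c hc
    exact ⟨_, _, .ofChart a c hc.1 M hM fun t ht => hℓ t ⟨ht.1, ht.2.trans hc.2⟩,
      .ofChart c b hc.2 M hM fun t ht => hℓ t ⟨hc.1.trans ht.1, ht.2⟩, by ring⟩
  | concat a b c m m' h h' ih ih' =>
    intro d hd
    rcases le_total d b with hdb | hbd
    · obtain ⟨m₁, m₂, h1, h2, rfl⟩ := ih d ⟨hd.1, hdb⟩
      exact ⟨m₁, m₂ + m', h1, .concat _ _ _ _ _ h2 h', by ring⟩
    · obtain ⟨m₁, m₂, h1, h2, rfl⟩ := ih' d ⟨hbd, hd.2⟩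
      exact ⟨m + m₁, m₂, .concat _ _ _ _ _ h h1, h2, by ring⟩

variable [FiniteDimensional ℝ V]

lemma isOpen_setOf_transverse (hω : ω.IsAlt) (hnd : ω.Nondegenerate) (N : Lagr ω) :
    IsOpen {L : Lagr ω | Transverse L N} := by
  obtain ⟨A, hA⟩ := exists_transverse hω hnd {N} (toFinite _) (singleton_nonempty N)
  refine TopologicalSpace.isOpen_generateFrom_of_mem
    ⟨A, N, (hA N rfl).symm, univ, @isOpen_univ _ (moduleTopology ℝ _), ?_⟩
  ext L
  simp

/-- The relative index of `M` and `L` changes only where `L` ceases to be transverse to `M`. -/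
lemma eventually_coindex_chart_eq (hω : ω.IsAlt) (hnd : ω.Nondegenerate) (N M L₀ : Lagr ω)
    (hM : Transverse M N) (h₀ : Transverse L₀ N) (hM₀ : Transverse L₀ M) :
    ∀ᶠ L in 𝓝 L₀, ∃ h : Transverse L N,
      coindex (chart M N L h) = coindex (chart M N L₀ h₀) := by
  have hker : LinearMap.ker (chart M N L₀ h₀) = ⊥ := by
    rw [← Submodule.finrank_eq_zero, finrank_ker_chart hnd hM h₀, dimInter_eq_zero hM₀.symm]
  obtain ⟨O, hO, hmem, hconst⟩ :=
    exists_isOpen_coindex_eq _ (isSymm_chart hω M N L₀ h₀) hker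
  have hopen : IsOpen {L : Lagr ω | ∃ h : Transverse L N, chart M N L h ∈ O} :=
    TopologicalSpace.isOpen_generateFrom_of_mem ⟨M, N, hM, O, hO, rfl⟩
  filter_upwards [hopen.mem_nhds ⟨h₀, hmem⟩]
  rintro L ⟨h, hL⟩
  exact ⟨h, hconst _ hL (isSymm_chart hω M N L h)⟩

lemma hormanderIndex_eq (hω : ω.IsAlt) (hnd : ω.Nondegenerate) {X Y N N' A B : Lagr ω}
    (hX : Transverse X N) (hY : Transverse Y N) (hA : Transverse A N) (hB : Transverse B N)
    (hX' : Transverse X N') (hY' : Transverse Y N') (hA' : Transverse A N')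
    (hB' : Transverse B N') :
    hormanderIndex X Y N A B hA hB = hormanderIndex X Y N' A B hA' hB' := by
  obtain ⟨M, hM⟩ := exists_transverse hω hnd {X, Y, A, B, N, N'} (toFinite _) ⟨X, by simp⟩
  simp only [mem_insert_iff, mem_singleton_iff, forall_eq_or_imp, forall_eq] at hM
  obtain ⟨hXM, hYM, hAM, hBM, hNM, hNM'⟩ := hM
  have h1 := coindex_chart_change hω hnd N M X A hX hA hNM.symm hXM hAM
  have h2 := coindex_chart_change hω hnd N M X B hX hB hNM.symm hXM hBM
  have h3 := coindex_chart_change hω hnd N M Y A hY hA hNM.symm hYM hAM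
  have h4 := coindex_chart_change hω hnd N M Y B hY hB hNM.symm hYM hBM
  have h5 := coindex_chart_change hω hnd N' M X A hX' hA' hNM'.symm hXM hAM
  have h6 := coindex_chart_change hω hnd N' M X B hX' hB' hNM'.symm hXM hBM
  have h7 := coindex_chart_change hω hnd N' M Y A hY' hA' hNM'.symm hYM hAM
  have h8 := coindex_chart_change hω hnd N' M Y B hY' hB' hNM'.symm hYM hBM
  simp only [hormanderIndex]
  omega

/-- A path contained in the chart domains along `M₀` and along `M₁`. Near each of its points both
sides can be computed in charts along one `N`, and the chart change formula leaves only the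
relative indices with `M₀` and `M₁`, which are locally constant along the path. As both sides
are additive, connectedness of the interval extends the equality. -/
lemma coindex_chart_sub_eq_hormanderIndex (hω : ω.IsAlt) (hnd : ω.Nondegenerate)
    {a b : ℝ} (hab : a ≤ b) {ℓ : ℝ → Lagr ω} (hℓ : ContinuousOn ℓ (Icc a b))
    {L₀ L₁ M₀ M₁ N : Lagr ω} (hM₀ : Transverse L₀ M₀) (hM₁ : Transverse L₁ M₁)
    (h₀ : ∀ t ∈ Icc a b, Transverse (ℓ t) M₀) (h₁ : ∀ t ∈ Icc a b, Transverse (ℓ t) M₁)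
    (ha₀ : Transverse (ℓ a) M₀) (hb₀ : Transverse (ℓ b) M₀)
    (ha₁ : Transverse (ℓ a) M₁) (hb₁ : Transverse (ℓ b) M₁)
    (hN₀ : Transverse L₀ N) (hN₁ : Transverse L₁ N)
    (ha : Transverse (ℓ a) N) (hb : Transverse (ℓ b) N) :
    ((coindex (chart L₀ M₀ (ℓ b) hb₀) : ℤ) - coindex (chart L₀ M₀ (ℓ a) ha₀))
      - ((coindex (chart L₁ M₁ (ℓ b) hb₁) : ℤ) - coindex (chart L₁ M₁ (ℓ a) ha₁))
      = hormanderIndex L₀ L₁ N (ℓ a) (ℓ b) ha hb := by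
  let P : ℝ → ℝ → Prop := fun s t =>
    ∀ (hs₀ : Transverse (ℓ s) M₀) (hs₁ : Transverse (ℓ s) M₁) (ht₀ : Transverse (ℓ t) M₀)
      (ht₁ : Transverse (ℓ t) M₁) (N : Lagr ω) (_ : Transverse L₀ N) (_ : Transverse L₁ N)
      (hs : Transverse (ℓ s) N) (ht : Transverse (ℓ t) N),
      ((coindex (chart L₀ M₀ (ℓ t) ht₀) : ℤ) - coindex (chart L₀ M₀ (ℓ s) hs₀))
      - ((coindex (chart L₁ M₁ (ℓ t) ht₁) : ℤ) - coindex (chart L₁ M₁ (ℓ s) hs₁))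
      = hormanderIndex L₀ L₁ N (ℓ s) (ℓ t) hs ht
  have key : P a b := by
    refine isPreconnected_Icc.induction₂ P ?_ ?_ ?_ (left_mem_Icc.2 hab) (right_mem_Icc.2 hab)
    · intro s hs
      obtain ⟨K, hK⟩ := exists_transverse hω hnd {L₀, L₁, ℓ s, M₀, M₁} (toFinite _)
        ⟨L₀, by simp⟩
      simp only [mem_insert_iff, mem_singleton_iff, forall_eq_or_imp, forall_eq] at hK
      obtain ⟨hK₀, hK₁, hKs, hKM₀, hKM₁⟩ := hK
      filter_upwards [(hℓ s hs).eventually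
          (eventually_coindex_chart_eq hω hnd K M₀ (ℓ s) hKM₀ hKs (h₀ s hs)),
        (hℓ s hs).eventually
          (eventually_coindex_chart_eq hω hnd K M₁ (ℓ s) hKM₁ hKs (h₁ s hs))]
      rintro t ⟨hKt, e₀⟩ ⟨_, e₁⟩ hs₀ hs₁ ht₀ ht₁ N hN₀ hN₁ hsN htN
      rw [hormanderIndex_eq hω hnd hN₀ hN₁ hsN htN hK₀ hK₁ hKs hKt]
      have c1 := coindex_chart_change hω hnd K M₀ L₀ (ℓ s) hK₀ hKs hKM₀ hM₀ hs₀
      have c2 := coindex_chart_change hω hnd K M₀ L₀ (ℓ t) hK₀ hKt hKM₀ hM₀ ht₀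
      have c3 := coindex_chart_change hω hnd K M₁ L₁ (ℓ s) hK₁ hKs hKM₁ hM₁ hs₁
      have c4 := coindex_chart_change hω hnd K M₁ L₁ (ℓ t) hK₁ hKt hKM₁ hM₁ ht₁
      simp only [hormanderIndex]
      omega
    · intro r s t _ hs _ h h' hr₀ hr₁ ht₀ ht₁ N hN₀ hN₁ hrN htN
      obtain ⟨K, hK⟩ := exists_transverse hω hnd {L₀, L₁, ℓ r, ℓ s, ℓ t} (toFinite _)
        ⟨L₀, by simp⟩
      simp only [mem_insert_iff, mem_singleton_iff, forall_eq_or_imp, forall_eq] at hK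
      obtain ⟨hK₀, hK₁, hKr, hKs, hKt⟩ := hK
      have e := h hr₀ hr₁ (h₀ s hs) (h₁ s hs) K hK₀ hK₁ hKr hKs
      have e' := h' (h₀ s hs) (h₁ s hs) ht₀ ht₁ K hK₀ hK₁ hKs hKt
      rw [hormanderIndex_eq hω hnd hN₀ hN₁ hrN htN hK₀ hK₁ hKr hKt,
        ← hormanderIndex_add L₀ L₁ K _ _ _ hKr hKs hKt, ← e, ← e']
      ring
    · intro s t _ _ h hs₀ hs₁ ht₀ ht₁ N hN₀ hN₁ hsN htN
      rw [hormanderIndex_swap, ← h ht₀ ht₁ hs₀ hs₁ N hN₀ hN₁ htN hsN]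
      ring
  exact key ha₀ ha₁ hb₀ hb₁ N hN₀ hN₁ ha hb

/-- Additivity of the Hörmander index for `A, B, C`, with charts along different `N` for the two
summands and for the sum. -/
lemma add_eq_hormanderIndex (hω : ω.IsAlt) (hnd : ω.Nondegenerate) {X Y A B C : Lagr ω}
    {k k' : ℤ}
    (h : ∀ (N : Lagr ω) (_ : Transverse X N) (_ : Transverse Y N) (hA : Transverse A N)
      (hB : Transverse B N), k = hormanderIndex X Y N A B hA hB)
    (h' : ∀ (N : Lagr ω) (_ : Transverse X N) (_ : Transverse Y N) (hB : Transverse B N)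
      (hC : Transverse C N), k' = hormanderIndex X Y N B C hB hC)
    (N : Lagr ω) (hX : Transverse X N) (hY : Transverse Y N) (hA : Transverse A N)
    (hC : Transverse C N) : k + k' = hormanderIndex X Y N A C hA hC := by
  obtain ⟨K, hK⟩ := exists_transverse hω hnd {X, Y, A, B, C} (toFinite _) ⟨X, by simp⟩
  simp only [mem_insert_iff, mem_singleton_iff, forall_eq_or_imp, forall_eq] at hK
  obtain ⟨hKX, hKY, hKA, hKB, hKC⟩ := hK
  rw [hormanderIndex_eq hω hnd hX hY hA hC hKX hKY hKA hKC,
    ← hormanderIndex_add X Y K _ _ _ hKA hKB hKC, ← h K hKX hKY hKA hKB, ← h' K hKX hKY hKB hKC]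

/-- A path contained in the chart domain along `M`, with the index relative to `L₁` computed from an
arbitrary partition. -/
lemma HasMaslovIndex.coindex_chart_sub_eq (hω : ω.IsAlt) (hnd : ω.Nondegenerate)
    {L₀ L₁ M : Lagr ω} (hM : Transverse L₀ M) {ℓ : ℝ → Lagr ω} {a b : ℝ} {m : ℤ}
    (h : HasMaslovIndex L₁ ℓ a b m) :
    ∀ (_ : ContinuousOn ℓ (Icc a b)) (_ : ∀ t ∈ Icc a b, Transverse (ℓ t) M)
      (ha : Transverse (ℓ a) M) (hb : Transverse (ℓ b) M)
      (N : Lagr ω) (_ : Transverse L₀ N) (_ : Transverse L₁ N) (haN : Transverse (ℓ a) N)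
      (hbN : Transverse (ℓ b) N),
      (coindex (chart L₀ M (ℓ b) hb) : ℤ) - coindex (chart L₀ M (ℓ a) ha) - m
        = hormanderIndex L₀ L₁ N (ℓ a) (ℓ b) haN hbN := by
  induction h with
  | ofChart a b hab M₁ hM₁ hℓ₁ =>
    intro hℓ hℓM ha hb N hN₀ hN₁ haN hbN
    exact coindex_chart_sub_eq_hormanderIndex hω hnd hab hℓ hM hM₁ hℓM hℓ₁ ha hb _ _ hN₀ hN₁
      haN hbN
  | concat a b c m m' h h' ih ih' =>
    intro hℓ hℓM ha hc N hN₀ hN₁ haN hcN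
    have hb := hℓM b ⟨h.le, h'.le⟩
    have hsub : Icc a b ⊆ Icc a c := Icc_subset_Icc_right h'.le
    have hsub' : Icc b c ⊆ Icc a c := Icc_subset_Icc_left h.le
    rw [← add_eq_hormanderIndex hω hnd
      (ih (hℓ.mono hsub) (fun t ht => hℓM t (hsub ht)) ha hb)
      (ih' (hℓ.mono hsub') (fun t ht => hℓM t (hsub' ht)) hb hc) N hN₀ hN₁ haN hcN]
    ring

/-- The difference of the Maslov indices of a path relative to two Lagrangians is the Hörmander
index of these and the endpoints. For `L₀ = L₁` this says that the Maslov index does not depend on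
the partition and the charts used to compute it. -/
lemma HasMaslovIndex.sub_eq_hormanderIndex (hω : ω.IsAlt) (hnd : ω.Nondegenerate)
    {L₀ L₁ : Lagr ω} {ℓ : ℝ → Lagr ω} {a b : ℝ} {m₀ : ℤ} (h₀ : HasMaslovIndex L₀ ℓ a b m₀) :
    ∀ (_ : ContinuousOn ℓ (Icc a b)) (m₁ : ℤ) (_ : HasMaslovIndex L₁ ℓ a b m₁)
      (N : Lagr ω) (_ : Transverse L₀ N) (_ : Transverse L₁ N) (ha : Transverse (ℓ a) N)
      (hb : Transverse (ℓ b) N),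
      m₀ - m₁ = hormanderIndex L₀ L₁ N (ℓ a) (ℓ b) ha hb := by
  induction h₀ with
  | ofChart a b hab M hM hℓM =>
    intro hℓ m₁ h₁
    exact h₁.coindex_chart_sub_eq hω hnd hM hℓ hℓM _ _
  | concat a b c m m' h h' ih ih' =>
    intro hℓ m₁ h₁ N hN₀ hN₁ haN hcN
    obtain ⟨k, k', hk, hk', rfl⟩ := h₁.exists_split b ⟨h.le, h'.le⟩
    rw [← add_eq_hormanderIndex hω hnd
      (ih (hℓ.mono (Icc_subset_Icc_right h'.le)) k hk)
      (ih' (hℓ.mono (Icc_subset_Icc_left h.le)) k' hk') N hN₀ hN₁ haN hcN]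
    ring

/-- Existence of the Maslov index: by compactness, the interval has a partition adapted to the
cover of the Lagrangian Grassmannian by the chart domains. -/
lemma exists_hasMaslovIndex (hω : ω.IsAlt) (hnd : ω.Nondegenerate) (L : Lagr ω)
    {a b : ℝ} (hab : a ≤ b) {ℓ : ℝ → Lagr ω} (hℓ : ContinuousOn ℓ (Icc a b)) :
    ∃ m : ℤ, HasMaslovIndex L ℓ a b m := by
  have hcov : ∀ A : Lagr ω, ∃ M, Transverse L M ∧ Transverse A M := by
    intro A
    obtain ⟨M, hM⟩ := exists_transverse hω hnd {L, A} (toFinite _) ⟨L, by simp⟩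
    exact ⟨M, hM L (by simp), hM A (by simp)⟩
  obtain ⟨t, ht0, htmono, ⟨k, hk⟩, ht⟩ := exists_monotone_Icc_subset_open_cover_Icc hab
    (c := fun M : {M : Lagr ω // Transverse L M} => {s : Icc a b | Transverse (ℓ s) M})
    (fun M => (isOpen_setOf_transverse hω hnd M.1).preimage hℓ.domRestrict)
    (fun s _ => by
      obtain ⟨M, hM, hs⟩ := hcov (ℓ s)
      exact mem_iUnion.2 ⟨⟨M, hM⟩, hs⟩)
  have hpart : ∀ n, ∃ m : ℤ, HasMaslovIndex L ℓ a (t n) m := by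
    intro n
    induction n with
    | zero =>
      obtain ⟨M, hM, ha⟩ := hcov (ℓ a)
      rw [ht0]
      exact ⟨_, .ofChart a a le_rfl M hM fun s hs => by rwa [← le_antisymm hs.1 hs.2]⟩
    | succ n ih =>
      obtain ⟨m, hm⟩ := ih
      obtain ⟨⟨M, hM⟩, hsub⟩ := ht n
      exact ⟨_, .concat _ _ _ _ _ hm (.ofChart (t n) (t (n + 1)) (htmono n.le_succ) M hM
        fun s hs => hsub (a := ⟨s, (t n).2.1.trans hs.1, hs.2.trans (t (n + 1)).2.2⟩) hs)⟩
  rw [← hk k le_rfl]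
  exact hpart k

lemma hasMaslovIndex_maslovIndex (hω : ω.IsAlt) (hnd : ω.Nondegenerate) (L : Lagr ω)
    {a b : ℝ} (hab : a ≤ b) {ℓ : ℝ → Lagr ω} (hℓ : ContinuousOn ℓ (Icc a b)) :
    HasMaslovIndex L ℓ a b (L.maslovIndex ℓ a b) :=
  Classical.epsilon_spec (exists_hasMaslovIndex hω hnd L hab hℓ)

end Paths

end Lagr

/-! ### Comparison of Maslov indices -/

theorem corollary3p4 {V : Type*} [AddCommGroup V] [Module ℝ V] [FiniteDimensional ℝ V]
    (ω : LinearMap.BilinForm ℝ V) (hω : ω.IsAlt) (hnd : ω.Nondegenerate)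
    (n : ℕ) (hn : finrank ℝ V = 2 * n)
    (a b : ℝ) (hab : a ≤ b) (ℓ : ℝ → Lagr ω) (hℓ : ContinuousOn ℓ (Icc a b))
    (L₀ L₁ : Lagr ω) :
    |L₀.maslovIndex ℓ a b - L₁.maslovIndex ℓ a b| ≤ (n : ℤ) - (ℓ a).dimInter (ℓ b) ∧
    |L₀.maslovIndex ℓ a b - L₁.maslovIndex ℓ a b
        - (ℓ a).dimInter L₀ + (ℓ a).dimInter L₁ + (ℓ b).dimInter L₀ - (ℓ b).dimInter L₁|
      ≤ (n : ℤ) - L₀.dimInter L₁ ∧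
    |L₀.maslovIndex ℓ a b - L₁.maslovIndex ℓ a b
        - (ℓ a).dimInter L₀ + (ℓ a).dimInter L₁ + (ℓ b).dimInter L₀ - (ℓ b).dimInter L₁|
      ≤ (n : ℤ) - (ℓ a).dimInter (ℓ b) := by
  obtain ⟨N, hN⟩ := Lagr.exists_transverse hω hnd {L₀, L₁, ℓ a, ℓ b} (toFinite _) ⟨L₀, by simp⟩
  simp only [mem_insert_iff, mem_singleton_iff, forall_eq_or_imp, forall_eq] at hN
  obtain ⟨h₀, h₁, hA, hB⟩ := hN
  have hdiff := (Lagr.hasMaslovIndex_maslovIndex hω hnd L₀ hab hℓ).sub_eq_hormanderIndex hω hnd hℓ _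
    (Lagr.hasMaslovIndex_maslovIndex hω hnd L₁ hab hℓ) N h₀ h₁ hA hB
  rw [Lagr.hormanderIndex] at hdiff
  have hrank : ∀ L : Lagr ω, finrank ℝ L.carrier = n := fun L => by
    have := L.two_mul_finrank
    omega
  have swap := fun X Y hX hY => (Lagr.coindex_chart_add_swap hω hnd N X Y hX hY).trans (hrank X)
  have triangle := fun X Y Z hX hY hZ => Lagr.coindex_chart_triangle hω N X Y Z hX hY hZ
  -- By `swap`, the dimensions in the statement are expressed by coindices along `N`; each bound
  -- then is the sum of two triangle inequalities.
  have s1 := swap (ℓ a) L₀ hA h₀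
  have s2 := swap (ℓ a) L₁ hA h₁
  have s3 := swap (ℓ b) L₀ hB h₀
  have s4 := swap (ℓ b) L₁ hB h₁
  have s5 := swap (ℓ a) (ℓ b) hA hB
  have s6 := swap L₀ L₁ h₀ h₁
  refine ⟨?_, ?_, ?_⟩
  · have t1 := triangle L₀ (ℓ a) (ℓ b) h₀ hA hB
    have t2 := triangle L₁ (ℓ b) (ℓ a) h₁ hB hA
    have t3 := triangle L₁ (ℓ a) (ℓ b) h₁ hA hB
    have t4 := triangle L₀ (ℓ b) (ℓ a) h₀ hB hA
    rw [abs_le]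
    constructor <;> omega
  · have t1 := triangle (ℓ a) L₀ L₁ hA h₀ h₁
    have t2 := triangle (ℓ a) L₁ L₀ hA h₁ h₀
    have t3 := triangle (ℓ b) L₀ L₁ hB h₀ h₁
    have t4 := triangle (ℓ b) L₁ L₀ hB h₁ h₀
    rw [abs_le]
    constructor <;> omega
  · have t1 := triangle (ℓ a) (ℓ b) L₀ hA hB h₀
    have t2 := triangle (ℓ b) (ℓ a) L₀ hB hA h₀
    have t3 := triangle (ℓ a) (ℓ b) L₁ hA hB h₁
    have t4 := triangle (ℓ b) (ℓ a) L₁ hB hA h₁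
    rw [abs_le]
    constructor <;> omega
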